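/- Let $d\ge 1$. For a random vector $X$ in $\mathbb{R}^d$ with probability density function $f_X$ (with respect to Lebesgue measure) and for $p>1$, let $$H_p(X)=\frac{1}{1-p}\log\int_{\mathbb{R}^d} f_X(x)^p\,dx\in[-\infty,\infty),\qquad \mathbf{V}_p(X)=\exp\Big(\frac{2}{d}H_p(X)\Big)\in[0,\infty)$$ be its Rényi entropy and Rényi entropy power of order $p$, where $H_p(X)=-\infty$ and $\mathbf{V}_p(X)=0$ if the integral diverges. Let $X$ and $Y$ be independent random vectors in $\mathbb{R}^d$ that have probability density functions, let $t\in(0,1)$, let $p>1$, and let $\alpha\ge\frac{p+1}{2}$. Then $\sqrt{t}\,X+\sqrt{1-t}\,Y$ has a probability density function, and $$\mathbf{V}_p(\sqrt{t}\,X+\sqrt{1-t}\,Y)^\alpha\;\ge\; t^\alpha\,\mathbf{V}_p(X)^\alpha+(1-t)^\alpha\,\mathbf{V}_p(Y)^\alpha .$$ -/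

import Mathlib

open MeasureTheory ProbabilityTheory

noncomputable section

/-- The Rényi differential entropy of order `p` of a random vector `X` in `ℝ^d`,
`H_p(X) = (1 / (1 - p)) log ∫ f_X(x)^p dx`, where `f_X` is the density of `X` with respect to
Lebesgue measure. It is extended-real valued: for `p > 1` it is `-∞` when the integral diverges. -/
def renyiEntropy {Ω : Type*} [MeasurableSpace Ω] {d : ℕ} (p : ℝ)
    (X : Ω → EuclideanSpace ℝ (Fin d)) (P : Measure Ω) : EReal :=
  ((1 / (1 - p) : ℝ) : EReal) *
    ENNReal.log (∫⁻ x : EuclideanSpace ℝ (Fin d), (pdf X P volume x) ^ p)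

/-- The Rényi entropy power of order `p`, `V_p(X) = exp ((2 / d) H_p(X))`, with the convention
`exp (-∞) = 0`. -/
def renyiEntropyPower {Ω : Type*} [MeasurableSpace Ω] {d : ℕ} (p : ℝ)
    (X : Ω → EuclideanSpace ℝ (Fin d)) (P : Measure Ω) : ENNReal :=
  EReal.exp (((2 / (d : ℝ) : ℝ) : EReal) * renyiEntropy p X P)

/-- The weighted sum `√t X + √(1 - t) Y` of two random vectors. -/
def weightedSum {Ω : Type*} {d : ℕ} (t : ℝ) (X Y : Ω → EuclideanSpace ℝ (Fin d)) :
    Ω → EuclideanSpace ℝ (Fin d) :=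
  fun ω => Real.sqrt t • X ω + Real.sqrt (1 - t) • Y ω

end

/-!
Young's inequality on `ℝ` with its sharp constant is the Brascamp–Lieb inequality for the maps
`(x, y) ↦ x`, `y`, `x + y` and exponents `cᵢ` of sum `2`. Following Barthe, each function is
transported monotonically to a Gaussian. The map assembled from the three transports is injective,
the arithmetic-geometric mean inequality bounds its Jacobian below, and completing a square leaves
an explicit Gaussian integral. The inequality tensorizes to `ℝ^d`, and duality turns it into a bound
on `∫ (f ⋆ g) ^ p`. Since `f` and `g` have integral one, interpolation bounds this by a constant
times `(∫ f ^ p) ^ l * (∫ g ^ p) ^ (1 - l)`, for every `l` in `(0, 1)`.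

With `A = V_p(X) ^ α`, `B = V_p(Y) ^ α` and `l = A / (A + B)` one has
`A + B = exp (h l) * A ^ l * B ^ (1 - l)`, where `h` is the binary entropy, so the theorem reduces
to comparing `h l` with the logarithm of the constant. For `α ≥ (p + 1) / 2` this holds because the
gap between the two is bounded below by a function of `l` that is concave and vanishes at `0`
and `1`. If `∫ f ^ p` or `∫ g ^ p` is infinite, Young's inequality `L¹ ⋆ L^p ⊆ L^p` suffices.
-/

section

open Set Real Filter Topology Finset

/-- The gap `q² h(l) - (2 - q) R(l)` in the sharp comparison of the binary entropy `h(l)` with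
`R(l) = η(1 - l q) + η(1 - (1 - l) q) - η(1 - q)`, where `η x = -x log x`. -/
noncomputable def entropyGap (q l : ℝ) : ℝ :=
  q ^ 2 * binEntropy l -
    (2 - q) * (negMulLog (1 - l * q) + negMulLog (1 - (1 - l) * q) - negMulLog (1 - q))

theorem hasDerivAt_entropyGap {q l : ℝ} (h0 : l ≠ 0) (h1 : l ≠ 1) (h2 : 1 - l * q ≠ 0)
    (h3 : 1 - (1 - l) * q ≠ 0) :
    HasDerivAt (entropyGap q)
      (q ^ 2 * (log (1 - l) - log l) -
        (2 - q) * (q * (log (1 - l * q) - log (1 - (1 - l) * q)))) l := by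
  have d₁ := (hasDerivAt_negMulLog h2).comp l (((hasDerivAt_id l).mul_const q).const_sub 1)
  have d₂ := (hasDerivAt_negMulLog h3).comp l
    ((((hasDerivAt_id l).const_sub 1).mul_const q).const_sub 1)
  exact (((hasDerivAt_binEntropy h0 h1).const_mul (q ^ 2)).sub
    (((d₁.add d₂).sub_const (negMulLog (1 - q))).const_mul (2 - q))).congr_deriv (by ring)

theorem hasDerivAt_deriv_entropyGap {q l : ℝ} (hl0 : 0 < l) (hl1 : l < 1) (h2 : 0 < 1 - l * q)
    (h3 : 0 < 1 - (1 - l) * q) :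
    HasDerivAt (fun x ↦ q ^ 2 * (log (1 - x) - log x) -
        (2 - q) * (q * (log (1 - x * q) - log (1 - (1 - x) * q))))
      (-(q ^ 2 * (1 - q) * (1 - 2 * l) ^ 2 /
        (l * (1 - l) * (1 - l * q) * (1 - (1 - l) * q)))) l := by
  have h1 : 0 < 1 - l := sub_pos.2 hl1
  have d₁ := ((hasDerivAt_id l).const_sub 1).log h1.ne'
  have d₂ := (((hasDerivAt_id l).mul_const q).const_sub 1).log h2.ne'
  have d₃ := ((((hasDerivAt_id l).const_sub 1).mul_const q).const_sub 1).log h3.ne'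
  refine (((d₁.sub (hasDerivAt_log hl0.ne')).const_mul (q ^ 2)).sub
    (((d₂.sub d₃).const_mul q).const_mul (2 - q))).congr_deriv ?_
  simp only [id_eq]
  have h2' := h2.ne'
  have h3' := h3.ne'
  generalize ha : 1 - l * q = a at h2' ⊢
  generalize hb : 1 - (1 - l) * q = b at h3' ⊢
  field_simp
  rw [← ha, ← hb]
  ring

theorem concaveOn_entropyGap {q : ℝ} (hq0 : 0 < q) (hq1 : q < 1) :
    ConcaveOn ℝ (Icc 0 1) (entropyGap q) := by
  have bounds : ∀ {x : ℝ}, x ∈ Ioo (0 : ℝ) 1 → 0 < 1 - x * q ∧ 0 < 1 - (1 - x) * q :=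
    fun {x} hx ↦ ⟨by nlinarith [hx.1, hx.2], by nlinarith [hx.1, hx.2]⟩
  refine concaveOn_of_hasDerivWithinAt2_nonpos (convex_Icc 0 1)
    (f' := fun x ↦ q ^ 2 * (log (1 - x) - log x) -
        (2 - q) * (q * (log (1 - x * q) - log (1 - (1 - x) * q))))
    (f'' := fun x ↦ -(q ^ 2 * (1 - q) * (1 - 2 * x) ^ 2 /
        (x * (1 - x) * (1 - x * q) * (1 - (1 - x) * q)))) ?_ ?_ ?_ ?_
  · have := continuous_negMulLog
    unfold entropyGap
    fun_prop
  all_goals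
    rw [interior_Icc]
    intro x hx
    obtain ⟨h2, h3⟩ := bounds hx
  · exact (hasDerivAt_entropyGap hx.1.ne' hx.2.ne h2.ne' h3.ne').hasDerivWithinAt
  · exact (hasDerivAt_deriv_entropyGap hx.1 hx.2 h2 h3).hasDerivWithinAt
  · have h0 := hx.1
    have h1 : 0 < 1 - x := sub_pos.2 hx.2
    have := sub_pos.2 hq1
    exact neg_nonpos.2 (by positivity)

theorem entropyGap_nonneg {q l : ℝ} (hq0 : 0 < q) (hq1 : q < 1) (hl : l ∈ Set.Icc (0 : ℝ) 1) :
    0 ≤ entropyGap q l := by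
  have endpoints : entropyGap q 0 = 0 ∧ entropyGap q 1 = 0 := by simp [entropyGap]
  simpa [endpoints] using (concaveOn_entropyGap hq0 hq1).min_le_of_mem_Icc
    (left_mem_Icc.2 zero_le_one) (right_mem_Icc.2 zero_le_one) hl

/-- Beckner's constant `√((1 - c)^(1 - c) / c^c)`: the sharp constant in Young's inequality for
the exponents `1 / cᵢ` is the product of these numbers. -/
noncomputable def becknerConst (c : ℝ) : ℝ := √((1 - c) ^ (1 - c) / c ^ c)

theorem becknerConst_pos {c : ℝ} (h0 : 0 < c) (h1 : c < 1) : 0 < becknerConst c := by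
  have := sub_pos.2 h1
  unfold becknerConst
  positivity

theorem log_becknerConst {c : ℝ} (h0 : 0 < c) (h1 : c < 1) :
    log (becknerConst c) = (negMulLog c - negMulLog (1 - c)) / 2 := by
  have h1' := sub_pos.2 h1
  rw [becknerConst, log_sqrt (by positivity), log_div (by positivity) (by positivity),
    log_rpow h1', log_rpow h0, negMulLog, negMulLog]
  ring

theorem sum_log_becknerConst {q l : ℝ} (hq0 : 0 < q) (hq1 : q < 1) (hl0 : 0 < l) (hl1 : l < 1) :
    log (becknerConst (1 - l * q)) + log (becknerConst (1 - (1 - l) * q)) +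
        log (becknerConst q) =
      (negMulLog (1 - l * q) + negMulLog (1 - (1 - l) * q) - negMulLog (1 - q) -
        q * binEntropy l) / 2 := by
  rw [log_becknerConst (by nlinarith) (by nlinarith),
    log_becknerConst (by nlinarith) (by nlinarith), log_becknerConst hq0 hq1,
    binEntropy_eq_negMulLog_add_negMulLog_one_sub, sub_sub_cancel, sub_sub_cancel,
    negMulLog_mul, negMulLog_mul]
  ring

theorem binEntropy_le_log_becknerConst {q l α : ℝ} (hq0 : 0 < q) (hq1 : q < 1) (hl0 : 0 < l)
    (hl1 : l < 1) (hα : (2 - q) / (2 * (1 - q)) ≤ α) :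
    binEntropy l ≤ -(2 * α / q) * (log (becknerConst (1 - l * q)) +
      log (becknerConst (1 - (1 - l) * q)) + log (becknerConst q)) := by
  have gap := entropyGap_nonneg hq0 hq1 ⟨hl0.le, hl1.le⟩
  rw [entropyGap] at gap
  rw [sum_log_becknerConst hq0 hq1 hl0 hl1]
  set R := negMulLog (1 - l * q) + negMulLog (1 - (1 - l) * q) - negMulLog (1 - q)
  have hh : 0 < binEntropy l := binEntropy_pos hl0 hl1
  have hD : 2 * (1 - q) * q * binEntropy l ≤ (2 - q) * (q * binEntropy l - R) := by linarith
  have hD0 : 0 ≤ q * binEntropy l - R := by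
    have : 0 < 2 * (1 - q) * q * binEntropy l := by have := sub_pos.2 hq1; positivity
    nlinarith
  rw [div_le_iff₀ (by linarith)] at hα
  have hα' := mul_le_mul_of_nonneg_right hα hD0
  have : binEntropy l * q ≤ α * (q * binEntropy l - R) := by
    refine le_of_mul_le_mul_left ?_ (by linarith : 0 < 2 * (1 - q))
    linarith
  calc binEntropy l ≤ α * (q * binEntropy l - R) / q := (le_div_iff₀ hq0).2 this
    _ = _ := by ring

theorem hasStrictDerivAt_integral_Iic {f : ℝ → ℝ} (hf : Continuous f) (hi : Integrable f) (x : ℝ) :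
    HasStrictDerivAt (fun x ↦ ∫ u in Iic x, f u) (f x) x := by
  refine ((hf.integral_hasStrictDerivAt 0 x).const_add (∫ u in Iic 0, f u)).congr_of_eventuallyEq
    (.of_forall fun y ↦ ?_)
  dsimp only
  rw [← intervalIntegral.integral_Iic_sub_Iic hi.integrableOn hi.integrableOn, add_sub_cancel]

theorem strictMono_integral_Iic {f : ℝ → ℝ} (hf : Continuous f) (hpos : ∀ x, 0 < f x)
    (hi : Integrable f) : StrictMono fun x ↦ ∫ u in Iic x, f u :=
  strictMono_of_deriv_pos fun x ↦
    (hasStrictDerivAt_integral_Iic hf hi x).hasDerivAt.deriv ▸ hpos x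

theorem range_integral_Iic {f : ℝ → ℝ} (hf : Continuous f) (hpos : ∀ x, 0 < f x)
    (hi : Integrable f) : range (fun x ↦ ∫ u in Iic x, f u) = Ioo 0 (∫ x, f x) := by
  have hmono := strictMono_integral_Iic hf hpos hi
  have htop : Tendsto (fun x ↦ ∫ u in Iic x, f u) atTop (𝓝 (∫ x, f x)) :=
    (aecover_Iic tendsto_id).integral_tendsto_of_countably_generated hi
  have hbot : Tendsto (fun x ↦ ∫ u in Iic x, f u) atBot (𝓝 0) :=
    tendsto_integral_Iic_zero tendsto_id
  have hcont : Continuous fun x ↦ ∫ u in Iic x, f u := continuous_iff_continuousAt.2 fun x ↦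
    (hasStrictDerivAt_integral_Iic hf hi x).hasDerivAt.continuousAt
  refine Subset.antisymm ?_ fun y hy ↦ ?_
  · rintro _ ⟨x, rfl⟩
    exact ⟨(hmono.monotone.le_of_tendsto hbot (x - 1)).trans_lt (hmono (sub_one_lt x)),
      (hmono (lt_add_one x)).trans_le (hmono.monotone.ge_of_tendsto htop (x + 1))⟩
  · obtain ⟨a, ha⟩ := (hbot.eventually_lt_const hy.1).exists
    obtain ⟨b, hb⟩ := (htop.eventually_const_lt hy.2).exists
    exact mem_range_of_exists_le_of_exists_ge hcont ⟨a, ha.le⟩ ⟨b, hb.le⟩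

theorem exists_strictMono_transport {f g : ℝ → ℝ} (hf : Continuous f) (hfpos : ∀ x, 0 < f x)
    (hfi : Integrable f) (hg : Continuous g) (hgpos : ∀ x, 0 < g x) (hgi : Integrable g)
    (hfg : ∫ x, f x = ∫ x, g x) :
    ∃ T : ℝ → ℝ, StrictMono T ∧ ∀ x, HasDerivAt T (f x / g (T x)) x := by
  set F := fun x ↦ ∫ u in Iic x, f u
  set G := fun x ↦ ∫ u in Iic x, g u
  have hF : StrictMono F := strictMono_integral_Iic hf hfpos hfi
  have hG : StrictMono G := strictMono_integral_Iic hg hgpos hgi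
  have hrange : range F = range G := by
    rw [range_integral_Iic hf hfpos hfi, range_integral_Iic hg hgpos hgi, hfg]
  set T := fun x ↦ Function.invFun G (F x)
  have hGT : ∀ x, G (T x) = F x := fun x ↦
    Function.invFun_eq (hrange ▸ mem_range_self x : F x ∈ range G)
  refine ⟨T, fun x y hxy ↦ hG.lt_iff_lt.1 (by simpa only [hGT] using hF hxy), fun x ↦ ?_⟩
  have hinv := (hasStrictDerivAt_integral_Iic hg hgi (T x)).to_local_left_inverse (hgpos _).ne'
    (.of_forall (Function.leftInverse_invFun hG.injective))
  rw [show ∫ u in Iic (T x), g u = F x from hGT x] at hinv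
  exact (hinv.hasDerivAt.comp x (hasStrictDerivAt_integral_Iic hf hfi x).hasDerivAt).congr_deriv
    (inv_mul_eq_div _ _)

/-- The centred Gaussian probability density `√s * exp (-π s x²)`, of variance `1 / (2 π s)`; this
parametrisation keeps the constants in the transport argument algebraic. -/
noncomputable def gaussDensity (s x : ℝ) : ℝ := √s * exp (-(π * s * x ^ 2))

theorem gaussDensity_pos {s : ℝ} (hs : 0 < s) (x : ℝ) : 0 < gaussDensity s x := by
  unfold gaussDensity
  positivity

theorem continuous_gaussDensity (s : ℝ) : Continuous (gaussDensity s) := by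
  unfold gaussDensity
  fun_prop

theorem integrable_gaussDensity {s : ℝ} (hs : 0 < s) : Integrable (gaussDensity s) := by
  unfold gaussDensity
  simpa only [neg_mul] using
    (integrable_exp_neg_mul_sq (mul_pos pi_pos hs)).const_mul √s

theorem integral_gaussDensity {s : ℝ} (hs : 0 < s) : ∫ x, gaussDensity s x = 1 := by
  have := integral_gaussian (π * s)
  simp only [neg_mul] at this
  simp only [gaussDensity]
  rw [integral_const_mul, this, div_mul_cancel_left₀ pi_ne_zero, sqrt_inv,
    mul_inv_cancel₀ (sqrt_pos.2 hs).ne']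

theorem lintegral_exp_neg_pi_mul_sq {s : ℝ} (hs : 0 < s) :
    ∫⁻ x : ℝ, ENNReal.ofReal (exp (-(π * s * x ^ 2))) = ENNReal.ofReal (1 / √s) := by
  have hi := integrable_exp_neg_mul_sq (mul_pos pi_pos hs)
  have h := ofReal_integral_eq_lintegral_ofReal hi (.of_forall fun x ↦ (exp_pos _).le)
  simp only [neg_mul] at h
  have h' := integral_gaussian (π * s)
  simp only [neg_mul] at h'
  rw [← h, h', div_mul_cancel_left₀ pi_ne_zero, sqrt_inv, one_div]

theorem lintegral_exp_neg_pi_mul_quadratic {a b c : ℝ} (ha : 0 < a) (hdet : 0 < a * c - b ^ 2) :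
    ∫⁻ z : ℝ × ℝ, ENNReal.ofReal
        (exp (-(π * (a * z.1 ^ 2 + 2 * b * (z.1 * z.2) + c * z.2 ^ 2)))) =
      ENNReal.ofReal (1 / √(a * c - b ^ 2)) := by
  set k := (a * c - b ^ 2) / a
  have hk : 0 < k := div_pos hdet ha
  have square : ∀ x y : ℝ, a * x ^ 2 + 2 * b * (x * y) + c * y ^ 2 =
      a * (x - (-(b / a) * y)) ^ 2 + k * y ^ 2 := fun x y ↦ by
    simp only [k]
    field_simp
    ring
  have inner : ∀ y : ℝ, ∫⁻ x : ℝ, ENNReal.ofReal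
        (exp (-(π * (a * x ^ 2 + 2 * b * (x * y) + c * y ^ 2)))) =
      ENNReal.ofReal (1 / √a) * ENNReal.ofReal (exp (-(π * k * y ^ 2))) := fun y ↦ by
    rw [← lintegral_exp_neg_pi_mul_sq ha, ← lintegral_mul_const' _ _ ENNReal.ofReal_ne_top,
      ← lintegral_sub_right_eq_self (fun x ↦ ENNReal.ofReal (exp (-(π * a * x ^ 2))) *
        ENNReal.ofReal (exp (-(π * k * y ^ 2)))) (-(b / a) * y)]
    refine lintegral_congr fun x ↦ ?_
    rw [square, ← ENNReal.ofReal_mul (exp_pos _).le, ← exp_add]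
    ring_nf
  rw [Measure.volume_eq_prod, lintegral_prod_symm' _ (by fun_prop)]
  simp only [inner]
  rw [lintegral_const_mul' _ _ ENNReal.ofReal_ne_top, lintegral_exp_neg_pi_mul_sq hk,
    ← ENNReal.ofReal_mul (by positivity), one_div_mul_one_div, ← sqrt_mul ha.le,
    mul_div_cancel₀ _ ha.ne']

theorem integral_pos_of_continuous_pos {f : ℝ → ℝ} (hf : Continuous f) (hpos : ∀ x, 0 < f x)
    (hi : Integrable f) : 0 < ∫ x, f x :=
  integral_pos_of_integrable_nonneg_nonzero hf hi (fun x ↦ (hpos x).le) (hpos 0).ne'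

theorem exists_strictMono_transport_gaussDensity {f : ℝ → ℝ} (hf : Continuous f)
    (hpos : ∀ x, 0 < f x) (hi : Integrable f) {s : ℝ} (hs : 0 < s) :
    ∃ T : ℝ → ℝ, StrictMono T ∧
      ∀ x, HasDerivAt T (f x / ((∫ y, f y) * gaussDensity s (T x))) x := by
  have hM := integral_pos_of_continuous_pos hf hpos hi
  refine exists_strictMono_transport hf hpos hi ((continuous_gaussDensity s).const_mul _)
    (fun x ↦ mul_pos hM (gaussDensity_pos hs x)) ((integrable_gaussDensity hs).const_mul _) ?_
  rw [integral_const_mul, integral_gaussDensity hs, mul_one]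

theorem prod_rpow_one_sub_le_sum_prod_erase {ι : Type*} [Fintype ι] [DecidableEq ι] {w m : ι → ℝ}
    (hw : ∀ i, 0 < w i) (hsum : ∑ i, w i = 1) (hm : ∀ i, 0 < m i) :
    ∏ i, m i ^ (1 - w i) ≤ (∏ i, w i ^ w i) * ∑ i, ∏ j ∈ univ.erase i, m j := by
  have pos : ∀ i, 0 < ∏ j ∈ univ.erase i, m j := fun i ↦ prod_pos fun j _ ↦ hm j
  have amgm := geom_mean_le_arith_mean_weighted univ w (fun i ↦ (∏ j ∈ univ.erase i, m j) / w i)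
    (fun i _ ↦ (hw i).le) hsum fun i _ ↦ (div_pos (pos i) (hw i)).le
  have split : ∏ i, (∏ j ∈ univ.erase i, m j) ^ w i = ∏ i, m i ^ (1 - w i) := by
    have erase : ∀ i, ∏ j ∈ univ.erase i, m j = (∏ j, m j) / m i := fun i ↦ by
      rw [eq_div_iff (hm i).ne', prod_erase_mul _ _ (mem_univ i)]
    have hP : 0 < ∏ j, m j := prod_pos fun j _ ↦ hm j
    simp only [erase, div_rpow hP.le (hm _).le, rpow_sub (hm _), rpow_one, prod_div_distrib]
    rw [← rpow_sum_of_pos hP, hsum, rpow_one]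
  simp only [mul_div_cancel₀ _ (hw _).ne', div_rpow (pos _).le (hw _).le, prod_div_distrib,
    split] at amgm
  rwa [div_le_iff₀' (prod_pos fun i _ ↦ rpow_pos_of_pos (hw i) _)] at amgm

theorem sum_prod_erase_fin_three (m : Fin 3 → ℝ) :
    ∑ i, ∏ j ∈ univ.erase i, m j = m 0 * m 1 + m 0 * m 2 + m 1 * m 2 := by
  rw [Fin.sum_univ_three, show (univ : Finset (Fin 3)).erase 0 = {1, 2} by decide,
    show (univ : Finset (Fin 3)).erase 1 = {0, 2} by decide,
    show (univ : Finset (Fin 3)).erase 2 = {0, 1} by decide, prod_pair (by decide),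
    prod_pair (by decide), prod_pair (by decide)]
  ring

/-- The three linear maps `(x, y) ↦ x`, `(x, y) ↦ y`, `(x, y) ↦ x + y` whose Brascamp–Lieb
inequality is the trilinear form of Young's convolution inequality. -/
def youngMap (E : Type*) [Add E] : Fin 3 → E × E → E := ![Prod.fst, Prod.snd, fun z ↦ z.1 + z.2]

/-- Barthe's transport map `Σᵢ Bᵢᵀ ∘ Sᵢ ∘ Bᵢ` for the three linear forms `Bᵢ = youngMap ℝ i`. -/
def bartheMap (S : Fin 3 → ℝ → ℝ) (z : ℝ × ℝ) : ℝ × ℝ :=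
  (S 0 z.1 + S 2 (z.1 + z.2), S 1 z.2 + S 2 (z.1 + z.2))

theorem bartheMap_injective {S : Fin 3 → ℝ → ℝ} (hS : ∀ i, StrictMono (S i)) :
    Function.Injective (bartheMap S) := by
  rintro ⟨x, y⟩ ⟨x', y'⟩ h
  obtain ⟨e₁, e₂⟩ := Prod.mk.inj h
  have pos : ∀ i {u v}, u ≠ v → 0 < (S i u - S i v) * (u - v) := fun i u v huv ↦ by
    rcases huv.lt_or_gt with h | h
    · exact mul_pos_of_neg_of_neg (sub_neg.2 (hS i h)) (sub_neg.2 h)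
    · exact mul_pos (sub_pos.2 (hS i h)) (sub_pos.2 h)
  have nonneg : ∀ i u v, 0 ≤ (S i u - S i v) * (u - v) := fun i u v ↦ by
    rcases eq_or_ne u v with rfl | huv
    · simp
    · exact (pos i huv).le
  have monotonicity : (S 0 x - S 0 x') * (x - x') + (S 1 y - S 1 y') * (y - y') +
      (S 2 (x + y) - S 2 (x' + y')) * (x + y - (x' + y')) = 0 := by
    linear_combination (x - x') * e₁ + (y - y') * e₂
  have n₂ := nonneg 2 (x + y) (x' + y')
  refine Prod.ext (by_contra fun hx ↦ ?_) (by_contra fun hy ↦ ?_)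
  · linarith [pos 0 hx, nonneg 1 y y']
  · linarith [pos 1 hy, nonneg 0 x x']

theorem hasFDerivAt_bartheMap {S : Fin 3 → ℝ → ℝ} {m : Fin 3 → ℝ} {z : ℝ × ℝ}
    (h₀ : HasDerivAt (S 0) (m 0) z.1) (h₁ : HasDerivAt (S 1) (m 1) z.2)
    (h₂ : HasDerivAt (S 2) (m 2) (z.1 + z.2)) :
    HasFDerivAt (bartheMap S) (Matrix.toLin (.finTwoProd ℝ) (.finTwoProd ℝ)
      !![m 0 + m 2, m 2; m 2, m 1 + m 2]).toContinuousLinearMap z := by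
  rw [Matrix.toLin_finTwoProd_toContinuousLinearMap]
  have fst : HasFDerivAt Prod.fst _ z := hasFDerivAt_fst (𝕜 := ℝ)
  have snd : HasFDerivAt Prod.snd _ z := hasFDerivAt_snd (𝕜 := ℝ)
  have d₂ := h₂.comp_hasFDerivAt z (fst.add snd)
  refine (((h₀.comp_hasFDerivAt z fst).add d₂).prodMk
    ((h₁.comp_hasFDerivAt z snd).add d₂)).congr_fderiv ?_
  ext <;> simp

theorem det_fderiv_bartheMap (m : Fin 3 → ℝ) :
    (Matrix.toLin (.finTwoProd ℝ) (.finTwoProd ℝ)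
      !![m 0 + m 2, m 2; m 2, m 1 + m 2]).toContinuousLinearMap.det =
      ∑ i, ∏ j ∈ univ.erase i, m j := by
  conv_lhs => rw [LinearMap.det_toContinuousLinearMap, LinearMap.det_toLin, Matrix.det_fin_two_of]
  rw [sum_prod_erase_fin_three]
  ring

theorem lintegral_mul_comp_bartheMap_le {S m : Fin 3 → ℝ → ℝ} (hS : ∀ i, StrictMono (S i))
    (hS' : ∀ i x, HasDerivAt (S i) (m i x) x) (g : ℝ × ℝ → ENNReal) :
    ∫⁻ z, ENNReal.ofReal (∑ i, ∏ j ∈ univ.erase i, m j (youngMap ℝ j z)) * g (bartheMap S z) ≤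
      ∫⁻ y, g y := by
  have change := lintegral_image_eq_lintegral_abs_det_fderiv_mul volume MeasurableSet.univ
    (fun z _ ↦ (hasFDerivAt_bartheMap (m := fun i ↦ m i (youngMap ℝ i z))
      (hS' 0 _) (hS' 1 _) (hS' 2 _)).hasFDerivWithinAt) (bartheMap_injective hS).injOn g
  rw [setLIntegral_univ] at change
  refine (lintegral_mono fun z ↦ ?_).trans
    (change.symm.trans_le (lintegral_mono' Measure.restrict_le_self le_rfl))
  rw [← det_fderiv_bartheMap fun i ↦ m i (youngMap ℝ i z)]
  gcongr
  exact le_abs_self _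

theorem becknerConst_mul_sqrt {c : ℝ} (h0 : 0 < c) (h1 : c < 1) :
    becknerConst c * √(1 - c) = (1 - c) ^ (1 - c) / c ^ c * √(c * (1 - c)) ^ c := by
  have h1' := sub_pos.2 h1
  have := becknerConst_pos h0 h1
  refine log_injOn_pos (mem_Ioi.2 (by positivity)) (mem_Ioi.2 (by positivity)) ?_
  rw [log_mul (by positivity) (by positivity), log_becknerConst h0 h1, log_sqrt h1'.le,
    log_mul (by positivity) (by positivity), log_div (by positivity) (by positivity),
    log_rpow h1', log_rpow h0, log_rpow (by positivity), log_sqrt (by positivity),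
    log_mul h0.ne' h1'.ne', negMulLog, negMulLog]
  ring

section Young

variable {c : Fin 3 → ℝ}

theorem pos_of_sum_eq_two (hc : ∀ i, c i < 1) (hsum : ∑ i, c i = 2) (i : Fin 3) : 0 < c i := by
  rw [Fin.sum_univ_three] at hsum
  match i with
  | 0 | 1 | 2 => linarith [hc 0, hc 1, hc 2]

/-- The quadratic form on `ℝ²` whose value at `z` is the minimum of `∑ i, cᵢ² (1 - cᵢ) xᵢ²` subject
to `z = (c₀ x₀ + c₂ x₂, c₁ x₁ + c₂ x₂)`. -/
def youngForm (c : Fin 3 → ℝ) (z : ℝ × ℝ) : ℝ :=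
  c 0 * (1 - c 0) * z.1 ^ 2 + 2 * (-((1 - c 0) * (1 - c 1))) * (z.1 * z.2) +
    c 1 * (1 - c 1) * z.2 ^ 2

theorem youngForm_le (hsum : ∑ i, c i = 2) (x : Fin 3 → ℝ) :
    youngForm c (c 0 * x 0 + c 2 * x 2, c 1 * x 1 + c 2 * x 2) ≤
      ∑ i, c i * (c i * (1 - c i)) * x i ^ 2 := by
  rw [Fin.sum_univ_three] at hsum ⊢
  have h2 : c 2 = 2 - c 0 - c 1 := by linarith
  rw [← sub_nonneg]
  refine (sq_nonneg ((1 - c 0) * (c 0 * x 0 + c 2 * x 2) + (1 - c 1) * (c 1 * x 1 + c 2 * x 2) -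
    c 2 * x 2)).trans_eq ?_
  simp only [youngForm, h2]
  ring

theorem lintegral_exp_neg_pi_mul_youngForm (hc : ∀ i, c i < 1) (hsum : ∑ i, c i = 2) :
    ∫⁻ z, ENNReal.ofReal (exp (-(π * youngForm c z))) =
      ENNReal.ofReal (∏ i, 1 / √(1 - c i)) := by
  have hpos := pos_of_sum_eq_two hc hsum
  have hc' : ∀ i, 0 < 1 - c i := fun i ↦ sub_pos.2 (hc i)
  have det : c 0 * (1 - c 0) * (c 1 * (1 - c 1)) - (-((1 - c 0) * (1 - c 1))) ^ 2 =
      (1 - c 0) * (1 - c 1) * (1 - c 2) := by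
    rw [Fin.sum_univ_three] at hsum
    rw [show c 2 = 2 - c 0 - c 1 by linarith]
    ring
  have det_pos := mul_pos (mul_pos (hc' 0) (hc' 1)) (hc' 2)
  rw [← det] at det_pos
  refine (lintegral_exp_neg_pi_mul_quadratic (mul_pos (hpos 0) (hc' 0)) det_pos).trans ?_
  rw [det, sqrt_mul (by have := hc' 0; have := hc' 1; positivity), sqrt_mul (hc' 0).le,
    Fin.prod_univ_three, one_div_mul_one_div, one_div_mul_one_div]

theorem prod_becknerConst_mul_lintegral_exp_neg_pi_mul_youngForm (hc : ∀ i, c i < 1)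
    (hsum : ∑ i, c i = 2) :
    ENNReal.ofReal (∏ i, becknerConst (c i) * √(1 - c i)) *
        ∫⁻ z, ENNReal.ofReal (exp (-(π * youngForm c z))) =
      ENNReal.ofReal (∏ i, becknerConst (c i)) := by
  rw [lintegral_exp_neg_pi_mul_youngForm hc hsum, ← ENNReal.ofReal_mul
    (prod_nonneg fun i _ ↦ mul_nonneg (becknerConst_pos (pos_of_sum_eq_two hc hsum i) (hc i)).le
      (sqrt_nonneg _)), ← prod_mul_distrib]
  refine congrArg _ (prod_congr rfl fun i _ ↦ ?_)
  rw [mul_assoc, mul_one_div_cancel (sqrt_pos.2 (sub_pos.2 (hc i))).ne', mul_one]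

theorem prod_gaussDensity_rpow_le (hsum : ∑ i, c i = 2) (x : Fin 3 → ℝ) :
    ∏ i, gaussDensity (c i * (1 - c i)) (x i) ^ c i ≤
      (∏ i, √(c i * (1 - c i)) ^ c i) *
        exp (-(π * youngForm c (c 0 * x 0 + c 2 * x 2, c 1 * x 1 + c 2 * x 2))) := by
  simp only [gaussDensity, mul_rpow (sqrt_nonneg _) (exp_pos _).le, prod_mul_distrib, ← exp_mul,
    ← exp_sum]
  gcongr
  calc ∑ i, -(π * (c i * (1 - c i)) * x i ^ 2) * c i
      = -(π * ∑ i, c i * (c i * (1 - c i)) * x i ^ 2) := by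
        rw [mul_sum, ← sum_neg_distrib]
        exact sum_congr rfl fun i _ ↦ by ring
    _ ≤ _ := neg_le_neg (mul_le_mul_of_nonneg_left (youngForm_le hsum x) pi_pos.le)

-- Here `t i` stands for the derivative of the transport of `f i` to a Gaussian of mass `M i`, so
-- the left side is `∏ i, f i ^ c i` and `∑ i, ∏ j ≠ i, c j * t j` is the Jacobian of `bartheMap`.
theorem prod_mul_gaussDensity_rpow_le (hc : ∀ i, c i < 1) (hsum : ∑ i, c i = 2)
    {t M : Fin 3 → ℝ} (ht : ∀ i, 0 < t i) (hM : ∀ i, 0 ≤ M i) (x : Fin 3 → ℝ) :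
    ∏ i, (t i * (M i * gaussDensity (c i * (1 - c i)) (x i))) ^ c i ≤
      (∏ i, M i ^ c i) * (∏ i, becknerConst (c i) * √(1 - c i)) *
        ((∑ i, ∏ j ∈ univ.erase i, c j * t j) *
          exp (-(π * youngForm c (c 0 * x 0 + c 2 * x 2, c 1 * x 1 + c 2 * x 2)))) := by
  have hpos := pos_of_sum_eq_two hc hsum
  have hc' : ∀ i, 0 < 1 - c i := fun i ↦ sub_pos.2 (hc i)
  have hs : ∀ i, 0 < c i * (1 - c i) := fun i ↦ mul_pos (hpos i) (hc' i)
  have hg : ∀ i, 0 < gaussDensity (c i * (1 - c i)) (x i) := fun i ↦ gaussDensity_pos (hs i) _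
  have hweight : ∑ i, (1 - c i) = 1 := by
    rw [sum_sub_distrib, hsum, Fin.sum_const]
    norm_num
  have amgm := prod_rpow_one_sub_le_sum_prod_erase (w := fun i ↦ 1 - c i) (m := fun i ↦ c i * t i)
    hc' hweight fun i ↦ mul_pos (hpos i) (ht i)
  simp only [sub_sub_cancel, mul_rpow (hpos _).le (ht _).le, prod_mul_distrib] at amgm
  simp only [becknerConst_mul_sqrt (hpos _) (hc _),
    mul_rpow (ht _).le (mul_nonneg (hM _) (hg _).le), mul_rpow (hM _) (hg _).le,
    prod_mul_distrib, prod_div_distrib]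
  have hcc : 0 < ∏ i, c i ^ c i := prod_pos fun i _ ↦ rpow_pos_of_pos (hpos i) _
  rw [← le_div_iff₀' hcc] at amgm
  have hMc : 0 ≤ ∏ i, M i ^ c i := prod_nonneg fun i _ ↦ rpow_nonneg (hM i) _
  calc _ = (∏ i, M i ^ c i) * ((∏ i, t i ^ c i) *
        ∏ i, gaussDensity (c i * (1 - c i)) (x i) ^ c i) := by ring
    _ ≤ (∏ i, M i ^ c i) * _ := mul_le_mul_of_nonneg_left (mul_le_mul amgm
        (prod_gaussDensity_rpow_le hsum x) (prod_nonneg fun i _ ↦ rpow_nonneg (hg i).le _)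
        ((prod_nonneg fun i _ ↦ rpow_nonneg (ht i).le _).trans amgm)) hMc
    _ = _ := by ring

theorem young_of_continuous_pos (hc : ∀ i, c i < 1) (hsum : ∑ i, c i = 2) {f : Fin 3 → ℝ → ℝ}
    (hf : ∀ i, Continuous (f i)) (hpos : ∀ i x, 0 < f i x) (hi : ∀ i, Integrable (f i)) :
    ∫⁻ z, ENNReal.ofReal (∏ i, f i (youngMap ℝ i z) ^ c i) ≤
      ENNReal.ofReal ((∏ i, becknerConst (c i)) * ∏ i, (∫ x, f i x) ^ c i) := by
  have hc0 := pos_of_sum_eq_two hc hsum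
  have hc' : ∀ i, 0 < 1 - c i := fun i ↦ sub_pos.2 (hc i)
  have hs : ∀ i, 0 < c i * (1 - c i) := fun i ↦ mul_pos (hc0 i) (hc' i)
  choose T hT hT' using fun i ↦
    exists_strictMono_transport_gaussDensity (hf i) (hpos i) (hi i) (hs i)
  have hM := fun i ↦ integral_pos_of_continuous_pos (hf i) (hpos i) (hi i)
  have hMg : ∀ i x, 0 < (∫ y, f i y) * gaussDensity (c i * (1 - c i)) x := fun i x ↦
    mul_pos (hM i) (gaussDensity_pos (hs i) x)
  set t : Fin 3 → ℝ → ℝ :=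
    fun i x ↦ f i x / ((∫ y, f i y) * gaussDensity (c i * (1 - c i)) (T i x))
  set K := (∏ i, (∫ x, f i x) ^ c i) * ∏ i, becknerConst (c i) * √(1 - c i) with hK_def
  have hM' : 0 ≤ ∏ i, (∫ x, f i x) ^ c i := prod_nonneg fun i _ ↦ rpow_nonneg (hM i).le _
  have hK : 0 ≤ K := mul_nonneg hM'
    (prod_nonneg fun i _ ↦ mul_nonneg (sqrt_nonneg _) (sqrt_nonneg _))
  have pointwise : ∀ z, ENNReal.ofReal (∏ i, f i (youngMap ℝ i z) ^ c i) ≤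
      ENNReal.ofReal K * (ENNReal.ofReal (∑ i, ∏ j ∈ univ.erase i, c j * t j (youngMap ℝ j z)) *
        ENNReal.ofReal (exp (-(π * youngForm c (bartheMap (fun i x ↦ c i * T i x) z))))) := by
    intro z
    have := prod_mul_gaussDensity_rpow_le hc hsum
      (fun i ↦ div_pos (hpos i (youngMap ℝ i z)) (hMg i (T i (youngMap ℝ i z))))
      (fun i ↦ (hM i).le) fun i ↦ T i (youngMap ℝ i z)
    simp only [div_mul_cancel₀ _ (hMg _ _).ne'] at this
    rw [← ENNReal.ofReal_mul' (exp_pos _).le, ← ENNReal.ofReal_mul hK]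
    exact ENNReal.ofReal_le_ofReal this
  calc ∫⁻ z, ENNReal.ofReal (∏ i, f i (youngMap ℝ i z) ^ c i)
      ≤ ENNReal.ofReal K * ∫⁻ z, ENNReal.ofReal (exp (-(π * youngForm c z))) := by
        refine (lintegral_mono pointwise).trans ?_
        rw [lintegral_const_mul' _ _ ENNReal.ofReal_ne_top]
        exact mul_le_mul_right (lintegral_mul_comp_bartheMap_le (fun i ↦ (hT i).const_mul (hc0 i))
          (fun i x ↦ (hT' i x).const_mul (c i)) _) _
    _ = _ := by
        rw [hK_def, ENNReal.ofReal_mul hM', mul_assoc,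
          prod_becknerConst_mul_lintegral_exp_neg_pi_mul_youngForm hc hsum,
          ← ENNReal.ofReal_mul hM', mul_comm]

end Young

section Approximation

variable {X : Type*} [TopologicalSpace X] [NormalSpace X] [MeasurableSpace X] [BorelSpace X]
  {μ : Measure X} [μ.WeaklyRegular] {ρ f : X → ℝ}

theorem exists_continuous_pos_lintegral_enorm_sub_le (hρ : Continuous ρ) (hρ0 : ∀ x, 0 < ρ x)
    (hρi : Integrable ρ μ) (hf0 : ∀ x, 0 ≤ f x) (hf : Integrable f μ) {ε : ENNReal} (hε : ε ≠ 0) :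
    ∃ φ : X → ℝ, Continuous φ ∧ (∀ x, 0 < φ x) ∧ Integrable φ μ ∧
      ∫⁻ x, ‖φ x - f x‖ₑ ∂μ ≤ ε := by
  obtain ⟨g, hg, hgi⟩ := hf.exists_boundedContinuous_lintegral_sub_le (ENNReal.half_pos hε).ne'
  obtain ⟨δ, hδ, hδε⟩ : ∃ δ : ℝ, 0 < δ ∧ ENNReal.ofReal δ * ∫⁻ x, ‖ρ x‖ₑ ∂μ ≤ ε / 2 := by
    obtain ⟨δ, hδ, h⟩ := ENNReal.exists_nnreal_pos_mul_lt hρi.2.ne (ENNReal.half_pos hε).ne'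
    exact ⟨δ, hδ, by simpa using h.le⟩
  refine ⟨fun x ↦ |g x| + δ * ρ x, by fun_prop, fun x ↦ ?_, hgi.abs.add (hρi.const_mul δ), ?_⟩
  · exact add_pos_of_nonneg_of_pos (abs_nonneg _) (mul_pos hδ (hρ0 x))
  have pointwise : ∀ x, ‖|g x| + δ * ρ x - f x‖ₑ ≤ ‖f x - g x‖ₑ + ENNReal.ofReal δ * ‖ρ x‖ₑ := by
    intro x
    have abs_le : ‖|g x| - f x‖ₑ ≤ ‖f x - g x‖ₑ := by
      simpa only [enorm_le_iff_norm_le, norm_eq_abs, abs_of_nonneg (hf0 x), abs_sub_comm (g x)]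
        using abs_abs_sub_abs_le (g x) (f x)
    rw [add_sub_right_comm, ← Real.enorm_of_nonneg hδ.le, ← enorm_mul]
    exact (enorm_add_le _ _).trans (add_le_add_left abs_le _)
  calc _ ≤ ∫⁻ x, ‖f x - g x‖ₑ + ENNReal.ofReal δ * ‖ρ x‖ₑ ∂μ := lintegral_mono pointwise
    _ = ∫⁻ x, ‖f x - g x‖ₑ ∂μ + ENNReal.ofReal δ * ∫⁻ x, ‖ρ x‖ₑ ∂μ := by
        rw [lintegral_add_right' _ (hρi.1.enorm.const_mul _),
          lintegral_const_mul' _ _ ENNReal.ofReal_ne_top]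
    _ ≤ ε := (add_le_add hg hδε).trans_eq (ENNReal.add_halves ε)

theorem exists_continuous_pos_tendsto (hρ : Continuous ρ) (hρ0 : ∀ x, 0 < ρ x)
    (hρi : Integrable ρ μ) (hf0 : ∀ x, 0 ≤ f x) (hf : Integrable f μ) :
    ∃ φ : ℕ → X → ℝ, (∀ n, Continuous (φ n)) ∧ (∀ n x, 0 < φ n x) ∧ (∀ n, Integrable (φ n) μ) ∧
      (∀ᵐ x ∂μ, Tendsto (fun n ↦ φ n x) atTop (𝓝 (f x))) ∧
      Tendsto (fun n ↦ ∫ x, φ n x ∂μ) atTop (𝓝 (∫ x, f x ∂μ)) := by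
  choose φ hφ hφ0 hφi hφf using fun n : ℕ ↦
    exists_continuous_pos_lintegral_enorm_sub_le hρ hρ0 hρi hf0 hf
      (ENNReal.inv_ne_zero.2 (ENNReal.natCast_ne_top n))
  have tendsto_L1 : Tendsto (fun n ↦ ∫⁻ x, ‖φ n x - f x‖ₑ ∂μ) atTop (𝓝 0) :=
    tendsto_of_tendsto_of_tendsto_of_le_of_le tendsto_const_nhds ENNReal.tendsto_inv_nat_nhds_zero
      (fun _ ↦ zero_le) hφf
  obtain ⟨ns, hns, hae⟩ := (tendstoInMeasure_of_tendsto_eLpNorm one_ne_zero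
    (fun n ↦ (hφi n).1) hf.1 (by simpa only [eLpNorm_one_eq_lintegral_enorm, Pi.sub_apply]
      using tendsto_L1)).exists_seq_tendsto_ae
  exact ⟨φ ∘ ns, fun n ↦ hφ _, fun n ↦ hφ0 _, fun n ↦ hφi _, hae,
    (tendsto_integral_of_L1 f hf.1 (Eventually.of_forall hφi) tendsto_L1).comp hns.tendsto_atTop⟩

end Approximation

theorem ofReal_prod_toReal_rpow {ι : Type*} [Fintype ι] {a : ι → ENNReal} {c : ι → ℝ}
    (hc : ∀ i, 0 ≤ c i) (ha : ∀ i, a i ≠ ⊤) :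
    ENNReal.ofReal (∏ i, (a i).toReal ^ c i) = ∏ i, a i ^ c i := by
  simp only [ENNReal.toReal_rpow, ← ENNReal.toReal_prod]
  exact ENNReal.ofReal_toReal (ENNReal.prod_ne_top fun i _ ↦
    ENNReal.rpow_ne_top_of_nonneg (hc i) (ha i))

/-- The Brascamp–Lieb inequality for the maps `B i`, with exponents `c i` and constant `K`. -/
def BrascampLieb {ι E : Type*} {F : ι → Type*} [Fintype ι] [MeasureSpace E]
    [∀ i, MeasureSpace (F i)] (B : ∀ i, E → F i) (c : ι → ℝ) (K : ENNReal) : Prop :=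
  ∀ f : ∀ i, F i → ENNReal, (∀ i, Measurable (f i)) →
    ∫⁻ z, ∏ i, f i (B i z) ^ c i ≤ K * ∏ i, (∫⁻ x, f i x) ^ c i

namespace BrascampLieb

section Approximation

variable {ι E : Type*} {F : ι → Type*} [Fintype ι] [MeasureSpace E] [∀ i, MeasureSpace (F i)]
  [∀ i, TopologicalSpace (F i)] [∀ i, NormalSpace (F i)] [∀ i, BorelSpace (F i)]
  [∀ i, (volume : Measure (F i)).WeaklyRegular] {B : ∀ i, E → F i} {c : ι → ℝ} {K : ℝ}
  {ρ : ∀ i, F i → ℝ}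

theorem lintegral_ofReal_prod_rpow_le
    (hB : ∀ i, Measure.QuasiMeasurePreserving (B i)) (hc : ∀ i, 0 < c i)
    (hρ : ∀ i, Continuous (ρ i)) (hρ0 : ∀ i x, 0 < ρ i x) (hρi : ∀ i, Integrable (ρ i))
    (h : ∀ φ : ∀ i, F i → ℝ, (∀ i, Continuous (φ i)) → (∀ i x, 0 < φ i x) →
      (∀ i, Integrable (φ i)) → ∫⁻ z, ENNReal.ofReal (∏ i, φ i (B i z) ^ c i) ≤
        ENNReal.ofReal (K * ∏ i, (∫ x, φ i x) ^ c i))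
    {f : ∀ i, F i → ℝ} (hf0 : ∀ i x, 0 ≤ f i x) (hf : ∀ i, Integrable (f i)) :
    ∫⁻ z, ENNReal.ofReal (∏ i, f i (B i z) ^ c i) ≤
      ENNReal.ofReal (K * ∏ i, (∫ x, f i x) ^ c i) := by
  choose φ hφ hφ0 hφi hφae hφlim using fun i ↦
    exists_continuous_pos_tendsto (hρ i) (hρ0 i) (hρi i) (hf0 i) (hf i)
  have hae : ∀ᵐ z, Tendsto (fun n ↦ ENNReal.ofReal (∏ i, φ i n (B i z) ^ c i)) atTop
      (𝓝 (ENNReal.ofReal (∏ i, f i (B i z) ^ c i))) := by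
    filter_upwards [ae_all_iff.2 fun i ↦ (hB i).ae (hφae i)] with z hz
    exact ENNReal.tendsto_ofReal <| tendsto_finsetProd _ fun i _ ↦
      (hz i).rpow_const (Or.inr (hc i).le)
  have hlim : Tendsto (fun n ↦ ENNReal.ofReal (K * ∏ i, (∫ x, φ i n x) ^ c i)) atTop
      (𝓝 (ENNReal.ofReal (K * ∏ i, (∫ x, f i x) ^ c i))) :=
    ENNReal.tendsto_ofReal <| (tendsto_finsetProd _ fun i _ ↦
      (hφlim i).rpow_const (Or.inr (hc i).le)).const_mul K
  have hmeas : ∀ n, Measurable fun z ↦ ENNReal.ofReal (∏ i, φ i n (B i z) ^ c i) := fun n ↦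
    (Finset.measurable_prod _ fun i _ ↦
      ((hφ i n).measurable.comp (hB i).measurable).pow_const _).ennreal_ofReal
  calc ∫⁻ z, ENNReal.ofReal (∏ i, f i (B i z) ^ c i)
      = ∫⁻ z, liminf (fun n ↦ ENNReal.ofReal (∏ i, φ i n (B i z) ^ c i)) atTop :=
        lintegral_congr_ae (hae.mono fun z hz ↦ hz.liminf_eq.symm)
    _ ≤ liminf (fun n ↦ ∫⁻ z, ENNReal.ofReal (∏ i, φ i n (B i z) ^ c i)) atTop :=
        lintegral_liminf_le hmeas
    _ ≤ liminf (fun n ↦ ENNReal.ofReal (K * ∏ i, (∫ x, φ i n x) ^ c i)) atTop :=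
        liminf_le_liminf <| Eventually.of_forall fun n ↦
          h _ (fun i ↦ hφ i n) (fun i ↦ hφ0 i n) fun i ↦ hφi i n
    _ = _ := hlim.liminf_eq

theorem of_continuous_pos (hK : 0 < K)
    (hB : ∀ i, Measure.QuasiMeasurePreserving (B i)) (hc : ∀ i, 0 < c i)
    (hρ : ∀ i, Continuous (ρ i)) (hρ0 : ∀ i x, 0 < ρ i x) (hρi : ∀ i, Integrable (ρ i))
    (h : ∀ φ : ∀ i, F i → ℝ, (∀ i, Continuous (φ i)) → (∀ i x, 0 < φ i x) →
      (∀ i, Integrable (φ i)) → ∫⁻ z, ENNReal.ofReal (∏ i, φ i (B i z) ^ c i) ≤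
        ENNReal.ofReal (K * ∏ i, (∫ x, φ i x) ^ c i)) :
    BrascampLieb B c (ENNReal.ofReal K) := by
  intro f hf
  by_cases h0 : ∃ j, ∫⁻ x, f j x = 0
  · obtain ⟨j, hj⟩ := h0
    refine le_of_eq_of_le ?_ zero_le
    rw [← lintegral_zero (μ := (volume : Measure E))]
    refine lintegral_congr_ae ?_
    filter_upwards [(hB j).ae ((lintegral_eq_zero_iff (hf j)).1 hj)] with z hz
    exact prod_eq_zero (mem_univ j) (by rw [hz]; exact ENNReal.zero_rpow_of_pos (hc j))
  by_cases htop : ∃ j, ∫⁻ x, f j x = ⊤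
  · obtain ⟨j, hj⟩ := htop
    have : ∏ i, (∫⁻ x, f i x) ^ c i = ⊤ := by
      refine WithTop.prod_eq_top (mem_univ j) (by rw [hj]; exact ENNReal.top_rpow_of_pos (hc j)) ?_
      intro i _
      exact fun h ↦ h0 ⟨i, (ENNReal.rpow_eq_zero_iff_of_pos (hc i)).1 h⟩
    rw [this, ENNReal.mul_top (ENNReal.ofReal_pos.2 hK).ne']
    exact le_top
  push Not at htop
  have hprod := lintegral_ofReal_prod_rpow_le hB hc hρ hρ0 hρi h
    (f := fun i x ↦ (f i x).toReal) (fun i x ↦ ENNReal.toReal_nonneg)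
    fun i ↦ integrable_toReal_of_lintegral_ne_top (hf i).aemeasurable (htop i)
  simp only [integral_toReal (hf _).aemeasurable (ae_lt_top (hf _) (htop _)),
    ENNReal.ofReal_mul hK.le, ofReal_prod_toReal_rpow (fun i ↦ (hc i).le) htop] at hprod
  refine le_of_eq_of_le (lintegral_congr_ae ?_) hprod
  filter_upwards [ae_all_iff.2 fun i ↦ (hB i).ae (ae_lt_top (hf i) (htop i))] with z hz
  exact (ofReal_prod_toReal_rpow (fun i ↦ (hc i).le) fun i ↦ (hz i).ne).symm

end Approximation

section Tensorization

variable {ι E E' : Type*} {F F' : ι → Type*} [Fintype ι] [MeasureSpace E] [MeasureSpace E']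
  [∀ i, MeasureSpace (F i)] [∀ i, MeasureSpace (F' i)] {B : ∀ i, E → F i} {B' : ∀ i, E' → F' i}
  {c : ι → ℝ} {K K' : ENNReal}

theorem of_measurePreserving (h : BrascampLieb B c K) {e : E → E'} (he : MeasurePreserving e)
    (hB' : ∀ i, Measurable (B' i)) {e' : ∀ i, F i → F' i} (he' : ∀ i, MeasurePreserving (e' i))
    (hcomm : ∀ i z, B' i (e z) = e' i (B i z)) : BrascampLieb B' c K := by
  intro f hf
  have := h (fun i ↦ f i ∘ e' i) fun i ↦ (hf i).comp (he' i).measurable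
  simp only [Function.comp_apply, ← hcomm, (he' _).lintegral_comp (hf _)] at this
  rwa [he.lintegral_comp (f := fun z ↦ ∏ i, f i (B' i z) ^ c i)
    (Finset.measurable_prod _ fun i _ ↦ ((hf i).comp (hB' i)).pow_const _)] at this

theorem prod [SFinite (volume : Measure E')]
    [∀ i, SFinite (volume : Measure (F' i))]
    (hB : ∀ i, Measurable (B i)) (hB' : ∀ i, Measurable (B' i))
    (h : BrascampLieb B c K) (h' : BrascampLieb B' c K') :
    BrascampLieb (fun i ↦ Prod.map (B i) (B' i)) c (K * K') := by
  intro f hf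
  have hmeas : Measurable fun z : E × E' ↦ ∏ i, f i (B i z.1, B' i z.2) ^ c i :=
    Finset.measurable_prod _ fun i _ ↦
      ((hf i).comp ((hB i).prodMap (hB' i))).pow_const _
  have fiber : ∀ i y, Measurable fun x ↦ f i (y, x) := fun i y ↦
    (hf i).comp measurable_prodMk_left
  have marginal : ∀ i, Measurable fun y ↦ ∫⁻ x, f i (y, x) := fun i ↦ (hf i).lintegral_prod_right'
  calc ∫⁻ z, ∏ i, f i (Prod.map (B i) (B' i) z) ^ c i
      = ∫⁻ z, ∫⁻ z', ∏ i, f i (B i z, B' i z') ^ c i := lintegral_prod _ hmeas.aemeasurable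
    _ ≤ ∫⁻ z, K' * ∏ i, (∫⁻ x, f i (B i z, x)) ^ c i :=
        lintegral_mono fun z ↦ h' _ fun i ↦ fiber i _
    _ = K' * ∫⁻ z, ∏ i, (∫⁻ x, f i (B i z, x)) ^ c i :=
        lintegral_const_mul _ <| Finset.measurable_prod _ fun i _ ↦
          ((marginal i).comp (hB i)).pow_const _
    _ ≤ K' * (K * ∏ i, (∫⁻ y, ∫⁻ x, f i (y, x)) ^ c i) := by
        gcongr
        exact h _ marginal
    _ = K * K' * ∏ i, (∫⁻ x, f i x) ^ c i := by
        simp only [Measure.volume_eq_prod, lintegral_prod _ (hf _).aemeasurable]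
        ring

end Tensorization

theorem pi {ι E : Type*} {F : ι → Type*} [Fintype ι] [MeasureSpace E] [∀ i, MeasureSpace (F i)]
    [SigmaFinite (volume : Measure E)] [∀ i, SigmaFinite (volume : Measure (F i))]
    {B : ∀ i, E → F i} {c : ι → ℝ} {K : ENNReal} (hB : ∀ i, Measurable (B i))
    (h : BrascampLieb B c K) (d : ℕ) :
    BrascampLieb (fun i (z : Fin d → E) k ↦ B i (z k)) c (K ^ d) := by
  induction d with
  | zero =>
    intro f _
    simp only [Measure.volume_pi_eq_dirac (isEmptyElim : ∀ _ : Fin 0, _), lintegral_unique,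
      Measure.dirac_apply_of_mem (mem_univ _), mul_one, pow_zero, one_mul]
    exact (prod_congr rfl fun i _ ↦ by congr 2; exact Subsingleton.elim _ _).le
  | succ d ih =>
    have hmeas : ∀ (n : ℕ) (i : ι), Measurable fun (z : Fin n → E) k ↦ B i (z k) := fun n i ↦
      measurable_pi_lambda _ fun k ↦ (hB i).comp (measurable_pi_apply k)
    rw [pow_succ']
    refine (h.prod hB (hmeas d) ih).of_measurePreserving
      (volume_preserving_piFinSuccAbove (fun _ ↦ E) 0).symm (hmeas _)
      (fun i ↦ (volume_preserving_piFinSuccAbove (fun _ ↦ F i) 0).symm) fun i z ↦ ?_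
    ext k
    refine Fin.cases ?_ (fun j ↦ ?_) k <;> simp [MeasurableEquiv.piFinSuccAbove]

end BrascampLieb

theorem quasiMeasurePreserving_youngMap {E : Type*} [MeasureSpace E] [AddGroup E]
    [MeasurableAdd₂ E] [SFinite (volume : Measure E)]
    [(volume : Measure E).IsAddLeftInvariant] (i : Fin 3) :
    Measure.QuasiMeasurePreserving (youngMap E i) := by
  fin_cases i
  · exact Measure.quasiMeasurePreserving_fst
  · exact Measure.quasiMeasurePreserving_snd
  · exact Measure.quasiMeasurePreserving_snd.comp
      (measurePreserving_prod_add (volume : Measure E) volume).quasiMeasurePreserving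

theorem brascampLieb_youngMap_real {c : Fin 3 → ℝ} (hc : ∀ i, c i < 1) (hsum : ∑ i, c i = 2) :
    BrascampLieb (youngMap ℝ) c (ENNReal.ofReal (∏ i, becknerConst (c i))) :=
  BrascampLieb.of_continuous_pos
    (prod_pos fun i _ ↦ becknerConst_pos (pos_of_sum_eq_two hc hsum i) (hc i))
    quasiMeasurePreserving_youngMap (pos_of_sum_eq_two hc hsum)
    (fun _ ↦ continuous_gaussDensity 1) (fun _ ↦ gaussDensity_pos one_pos)
    (fun _ ↦ integrable_gaussDensity one_pos)
    fun _ hf hpos hi ↦ young_of_continuous_pos hc hsum hf hpos hi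

theorem brascampLieb_youngMap_euclideanSpace {c : Fin 3 → ℝ} (hc : ∀ i, c i < 1)
    (hsum : ∑ i, c i = 2) (d : ℕ) :
    BrascampLieb (youngMap (EuclideanSpace ℝ (Fin d))) c
      (ENNReal.ofReal (∏ i, becknerConst (c i)) ^ d) := by
  refine ((brascampLieb_youngMap_real hc hsum).pi
      (fun i ↦ (quasiMeasurePreserving_youngMap i).measurable) d).of_measurePreserving
    (((PiLp.volume_preserving_toLp (Fin d)).prod (PiLp.volume_preserving_toLp (Fin d))).comp
      (volume_measurePreserving_arrowProdEquivProdArrow ℝ ℝ (Fin d)))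
    (fun i ↦ (quasiMeasurePreserving_youngMap i).measurable)
    (fun _ ↦ PiLp.volume_preserving_toLp (Fin d)) fun i z ↦ ?_
  fin_cases i <;> rfl

theorem le_rpow_of_le_mul_rpow {A J : ENNReal} (hJ : J ≠ ⊤) {p : ℝ} (hp : 1 ≤ p)
    (h : J ≤ A * J ^ (1 - 1 / p)) : J ≤ A ^ p := by
  have hp0 : 0 < p := one_pos.trans_le hp
  rcases eq_or_ne J 0 with rfl | hJ0
  · exact zero_le
  have hq : 0 ≤ 1 - 1 / p := by rw [sub_nonneg, div_le_one hp0]; exact hp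
  have hpos : J ^ (1 - 1 / p) ≠ 0 := (ENNReal.rpow_pos (pos_iff_ne_zero.2 hJ0) hJ).ne'
  have hfin : J ^ (1 - 1 / p) ≠ ⊤ := ENNReal.rpow_ne_top_of_nonneg hq hJ
  have factor : J ^ (1 / p) * J ^ (1 - 1 / p) = J := by
    rw [← ENNReal.rpow_add _ _ hJ0 hJ, add_sub_cancel, ENNReal.rpow_one]
  have root_le : J ^ (1 / p) ≤ A := by
    rw [← ENNReal.mul_le_mul_iff_left hpos hfin, factor]
    exact h
  exact (ENNReal.rpow_inv_le_iff hp0).1 (by rwa [← one_div])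

theorem exists_simpleFunc_lintegral_lt_top_of_lt_lintegral {X : Type*} [MeasurableSpace X]
    {μ : Measure X} [SigmaFinite μ] {f : X → ENNReal} {L : ENNReal} (hL : L < ∫⁻ x, f x ∂μ) :
    ∃ g : SimpleFunc X NNReal, (∀ x, g x ≤ f x) ∧ ∫⁻ x, g x ∂μ < ⊤ ∧ L < ∫⁻ x, g x ∂μ := by
  simp only [lintegral_eq_nnreal, lt_iSup_iff] at hL
  obtain ⟨φ, hφ, hL⟩ := hL
  rw [← SimpleFunc.lintegral_eq_lintegral] at hL
  obtain ⟨g, hgφ, hg⟩ := exists_lt_lintegral_simpleFunc_of_lt_lintegral (f := φ) hL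
  exact ⟨g, fun x ↦ (ENNReal.coe_le_coe.2 (hgφ x)).trans (hφ x), hg⟩

-- Testing against simple functions `g ≤ k ^ p` of finite integral allows the factor
-- `(∫ g) ^ (1 - 1 / p)` to be cancelled, even when `∫ k ^ p = ⊤`.
theorem lintegral_rpow_le_of_forall_lintegral_mul_le {X : Type*} [MeasurableSpace X] {μ : Measure X}
    [SigmaFinite μ] {p : ℝ} (hp : 1 ≤ p) {k : X → ENNReal} {A : ENNReal}
    (h : ∀ g : X → ENNReal, Measurable g →
      ∫⁻ x, k x * g x ^ (1 - 1 / p) ∂μ ≤ A * (∫⁻ x, g x ∂μ) ^ (1 - 1 / p)) :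
    ∫⁻ x, k x ^ p ∂μ ≤ A ^ p := by
  have hp0 : 0 < p := one_pos.trans_le hp
  refine le_of_forall_lt fun L hL ↦ ?_
  obtain ⟨g, hgk, hg, hLg⟩ := exists_simpleFunc_lintegral_lt_top_of_lt_lintegral hL
  refine hLg.trans_le (le_rpow_of_le_mul_rpow hg.ne hp ?_)
  refine le_trans (lintegral_mono fun x ↦ ?_) (h _ g.measurable.coe_nnreal_ennreal)
  have root_le : (g x : ENNReal) ^ (1 / p) ≤ k x := by
    rw [one_div]; exact (ENNReal.rpow_inv_le_iff hp0).2 (hgk x)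
  calc (g x : ENNReal) = (g x : ENNReal) ^ (1 / p) * (g x : ENNReal) ^ (1 - 1 / p) := by
        rw [← ENNReal.rpow_add_of_nonneg _ _ (by positivity) (by
          rw [sub_nonneg, div_le_one hp0]; exact hp), add_sub_cancel, ENNReal.rpow_one]
    _ ≤ _ := mul_le_mul_left root_le _

section Convolution

variable {E : Type*} [MeasureSpace E] [AddGroup E] [MeasurableAdd₂ E]
  [SigmaFinite (volume : Measure E)] [(volume : Measure E).IsAddLeftInvariant]

theorem brascampLieb_youngMap_one {θ : ℝ} (h0 : 0 ≤ θ) (h1 : θ ≤ 1) :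
    BrascampLieb (youngMap E) ![1, 1 - θ, θ] 1 := by
  intro f hf
  have holder : ∀ x, ∫⁻ y, f 1 y ^ (1 - θ) * f 2 (x + y) ^ θ ≤
      (∫⁻ y, f 1 y) ^ (1 - θ) * (∫⁻ y, f 2 y) ^ θ := fun x ↦ by
    rw [← lintegral_add_left_eq_self (f 2) x]
    exact ENNReal.lintegral_mul_norm_pow_le (hf 1).aemeasurable (by fun_prop)
      (sub_nonneg.2 h1) h0 (sub_add_cancel 1 θ)
  simp only [Fin.prod_univ_three, youngMap, Matrix.cons_val, ENNReal.rpow_one, one_mul]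
  calc ∫⁻ z : E × E, f 0 z.1 * f 1 z.2 ^ (1 - θ) * f 2 (z.1 + z.2) ^ θ
      = ∫⁻ x, ∫⁻ y, f 0 x * (f 1 y ^ (1 - θ) * f 2 (x + y) ^ θ) := by
        simp only [mul_assoc]
        exact lintegral_prod _ (by fun_prop)
    _ ≤ ∫⁻ x, f 0 x * ((∫⁻ y, f 1 y) ^ (1 - θ) * (∫⁻ y, f 2 y) ^ θ) := by
        refine lintegral_mono fun x ↦ ?_
        rw [lintegral_const_mul _ (by fun_prop)]
        exact mul_le_mul_right (holder x) _
    _ = _ := by rw [lintegral_mul_const _ (hf 0), mul_assoc]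

variable [MeasurableNeg E]

theorem lintegral_lconvolution_mul {f g h : E → ENNReal} (hf : Measurable f)
    (hg : Measurable g) (hh : Measurable h) :
    ∫⁻ x, lconvolution f g volume x * h x = ∫⁻ z : E × E, f z.1 * g z.2 * h (z.1 + z.2) := by
  calc _ = ∫⁻ z, ∫⁻ x, f x * (g (-x + z) * h z) := by
        refine lintegral_congr fun z ↦ ?_
        simp only [lconvolution_def, ← mul_assoc]
        exact (lintegral_mul_const _ (by fun_prop)).symm
    _ = ∫⁻ x, ∫⁻ z, f x * (g (-x + z) * h z) := lintegral_lintegral_swap (by fun_prop)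
    _ = ∫⁻ x, ∫⁻ y, f x * (g y * h (x + y)) := by
      refine lintegral_congr fun x ↦ ?_
      rw [← lintegral_add_left_eq_self _ x]
      simp only [neg_add_cancel_left]
    _ = _ := by
      rw [Measure.volume_eq_prod, lintegral_prod _ (by fun_prop)]
      simp only [mul_assoc]

theorem BrascampLieb.lintegral_lconvolution_rpow_le {c : Fin 3 → ℝ} {K : ENNReal} {p : ℝ}
    (h : BrascampLieb (youngMap E) c K) (hp : 1 ≤ p) (h0 : 0 < c 0) (h1 : 0 < c 1)
    (h2 : c 2 = 1 - 1 / p) {f g : E → ENNReal} (hf : Measurable f) (hg : Measurable g) :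
    ∫⁻ x, lconvolution f g volume x ^ p ≤
      (K * ((∫⁻ x, f x ^ (1 / c 0)) ^ c 0 * (∫⁻ x, g x ^ (1 / c 1)) ^ c 1)) ^ p := by
  refine lintegral_rpow_le_of_forall_lintegral_mul_le hp fun k hk ↦ ?_
  have trilinear := h ![fun x ↦ f x ^ (1 / c 0), fun x ↦ g x ^ (1 / c 1), k] fun i ↦ by
    fin_cases i
    exacts [hf.pow_const _, hg.pow_const _, hk]
  simp only [Fin.prod_univ_three, youngMap, Matrix.cons_val, ← ENNReal.rpow_mul,
    one_div_mul_cancel h0.ne', one_div_mul_cancel h1.ne', ENNReal.rpow_one, h2] at trilinear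
  rwa [lintegral_lconvolution_mul hf hg (hk.pow_const _), mul_assoc]

end Convolution

section Density

variable {X : Type*} [MeasurableSpace X] {μ : Measure X} {f : X → ENNReal}

theorem lintegral_rpow_div_rpow_le (hf : AEMeasurable f μ) {a b p : ℝ} (ha : 0 ≤ a) (hb : 0 ≤ b)
    (hab : 0 < a + b) (hp : 0 ≤ p) :
    (∫⁻ x, f x ^ ((a + p * b) / (a + b)) ∂μ) ^ (a + b) ≤
      (∫⁻ x, f x ∂μ) ^ a * (∫⁻ x, f x ^ p ∂μ) ^ b := by
  have holder := ENNReal.lintegral_mul_norm_pow_le hf (hf.pow_const p) (div_nonneg ha hab.le)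
    (div_nonneg hb hab.le) (by rw [← add_div, div_self hab.ne'])
  have exponent : ∀ x, f x ^ (a / (a + b)) * (f x ^ p) ^ (b / (a + b)) =
      f x ^ ((a + p * b) / (a + b)) := fun x ↦ by
    rw [← ENNReal.rpow_mul, ← ENNReal.rpow_add_of_nonneg _ _ (div_nonneg ha hab.le)
      (mul_nonneg hp (div_nonneg hb hab.le)), ← mul_div_assoc, ← add_div]
  simp only [exponent] at holder
  refine (ENNReal.rpow_le_rpow holder hab.le).trans_eq ?_
  rw [ENNReal.mul_rpow_of_nonneg _ _ hab.le, ← ENNReal.rpow_mul, ← ENNReal.rpow_mul,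
    div_mul_cancel₀ _ hab.ne', div_mul_cancel₀ _ hab.ne']

theorem lintegral_rpow_rpow_le_of_lintegral_eq_one (hf : AEMeasurable f μ)
    (hf1 : ∫⁻ x, f x ∂μ = 1) {m p : ℝ} (hm0 : 0 < m) (hm1 : m ≤ 1) (hp : 0 < p) :
    ((∫⁻ x, f x ^ (1 / (1 - m * (1 - 1 / p))) ∂μ) ^ (1 - m * (1 - 1 / p))) ^ p ≤
      (∫⁻ x, f x ^ p ∂μ) ^ m := by
  have interpolation := lintegral_rpow_div_rpow_le hf (sub_nonneg.2 hm1)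
    (div_nonneg hm0.le hp.le) (add_pos_of_nonneg_of_pos (sub_nonneg.2 hm1) (div_pos hm0 hp)) hp.le
  rw [hf1, ENNReal.one_rpow, one_mul, mul_div_cancel₀ _ hp.ne', sub_add_cancel,
    show 1 - m + m / p = 1 - m * (1 - 1 / p) by ring] at interpolation
  refine (ENNReal.rpow_le_rpow interpolation hp.le).trans_eq ?_
  rw [← ENNReal.rpow_mul, div_mul_cancel₀ _ hp.ne']

theorem lintegral_rpow_ne_zero (hf : Measurable f) (h : ∫⁻ x, f x ∂μ ≠ 0) {p : ℝ} (hp : 0 < p) :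
    ∫⁻ x, f x ^ p ∂μ ≠ 0 := by
  contrapose! h
  rw [lintegral_eq_zero_iff (hf.pow_const p)] at h
  rw [lintegral_eq_zero_iff hf]
  filter_upwards [h] with x hx
  exact (ENNReal.rpow_eq_zero_iff_of_pos hp).1 hx

end Density

theorem lintegral_lconvolution_rpow_le {E : Type*} [MeasureSpace E] [AddGroup E]
    [MeasurableAdd₂ E] [MeasurableNeg E] [SigmaFinite (volume : Measure E)]
    [(volume : Measure E).IsAddLeftInvariant] {p : ℝ} (hp : 1 ≤ p) {f g : E → ENNReal}
    (hf : Measurable f) (hg : Measurable g) :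
    ∫⁻ x, lconvolution f g volume x ^ p ≤ (∫⁻ x, f x) ^ p * ∫⁻ x, g x ^ p := by
  have hp0 : 0 < p := one_pos.trans_le hp
  have hinv : 1 / p ≤ 1 := (div_le_one hp0).2 hp
  have := (brascampLieb_youngMap_one (E := E) (θ := 1 - 1 / p) (sub_nonneg.2 hinv)
    (sub_le_self _ (one_div_nonneg.2 hp0.le))).lintegral_lconvolution_rpow_le hp
    one_pos (by simpa using hp0) rfl hf hg
  simpa only [Matrix.cons_val, sub_sub_cancel, one_div_one_div, div_one, ENNReal.rpow_one, one_mul,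
    ENNReal.mul_rpow_of_nonneg _ _ hp0.le, ← ENNReal.rpow_mul, one_div_mul_cancel hp0.ne']
    using this

/-- The exponents of the trilinear form of Young's inequality bounding the `L^p` norm of a
convolution, where `q = 1 - 1 / p` and `l`, `1 - l` are the weights given to the two factors. -/
noncomputable def youngExponent (l q : ℝ) : Fin 3 → ℝ := ![1 - l * q, 1 - (1 - l) * q, q]

theorem youngExponent_lt_one {l q : ℝ} (hl0 : 0 < l) (hl1 : l < 1) (hq0 : 0 < q) (hq1 : q < 1)
    (i : Fin 3) : youngExponent l q i < 1 := by
  fin_cases i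
  exacts [sub_lt_self _ (mul_pos hl0 hq0), sub_lt_self _ (mul_pos (sub_pos.2 hl1) hq0), hq1]

theorem sum_youngExponent (l q : ℝ) : ∑ i, youngExponent l q i = 2 := by
  simp only [youngExponent, Fin.sum_univ_three, Matrix.cons_val]
  ring

theorem lintegral_lconvolution_rpow_le_becknerConst {d : ℕ} {p : ℝ} (hp : 1 < p)
    {f g : EuclideanSpace ℝ (Fin d) → ENNReal} (hf : Measurable f) (hg : Measurable g)
    (hf1 : ∫⁻ x, f x = 1) (hg1 : ∫⁻ x, g x = 1) {l : ℝ} (hl0 : 0 < l) (hl1 : l < 1) :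
    ∫⁻ x, lconvolution f g volume x ^ p ≤
      (ENNReal.ofReal (∏ i, becknerConst (youngExponent l (1 - 1 / p) i)) ^ d) ^ p *
        ((∫⁻ x, f x ^ p) ^ l * (∫⁻ x, g x ^ p) ^ (1 - l)) := by
  have hp0 : 0 < p := one_pos.trans hp
  have hc := youngExponent_lt_one hl0 hl1 (sub_pos.2 ((div_lt_one hp0).2 hp))
    (sub_lt_self _ (one_div_pos.2 hp0))
  have hsum := sum_youngExponent l (1 - 1 / p)
  have young := (brascampLieb_youngMap_euclideanSpace hc hsum d).lintegral_lconvolution_rpow_le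
    hp.le (pos_of_sum_eq_two hc hsum 0) (pos_of_sum_eq_two hc hsum 1) rfl hf hg
  refine young.trans ?_
  rw [ENNReal.mul_rpow_of_nonneg _ _ hp0.le, ENNReal.mul_rpow_of_nonneg _ _ hp0.le]
  gcongr
  exacts [lintegral_rpow_rpow_le_of_lintegral_eq_one hf.aemeasurable hf1 hl0 hl1.le hp0,
    lintegral_rpow_rpow_le_of_lintegral_eq_one hg.aemeasurable hg1 (sub_pos.2 hl1)
      (sub_le_self _ hl0.le) hp0]

theorem exp_binEntropy_mul_rpow_mul_rpow {a b : ℝ} (ha : 0 < a) (hb : 0 < b) :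
    exp (binEntropy (a / (a + b))) * (a ^ (a / (a + b)) * b ^ (1 - a / (a + b))) = a + b := by
  have hab : 0 < a + b := add_pos ha hb
  have compl : 1 - a / (a + b) = b / (a + b) := by rw [one_sub_div hab.ne', add_sub_cancel_left]
  rw [binEntropy_eq_negMulLog_add_negMulLog_one_sub, compl, negMulLog, negMulLog,
    log_div ha.ne' hab.ne', log_div hb.ne' hab.ne', rpow_def_of_pos ha, rpow_def_of_pos hb,
    ← exp_add, ← exp_add]
  conv_rhs => rw [← exp_log hab]
  congr 1
  field_simp
  ring

theorem exists_add_le_becknerConst_rpow_mul {q α : ℝ} (hq0 : 0 < q) (hq1 : q < 1)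
    (hα : (2 - q) / (2 * (1 - q)) ≤ α) {a b : ℝ} (ha : 0 < a) (hb : 0 < b) :
    ∃ l, 0 < l ∧ l < 1 ∧
      a + b ≤ (∏ i, becknerConst (youngExponent l q i)) ^ (-(2 * α / q)) *
        (a ^ l * b ^ (1 - l)) := by
  have hl0 : 0 < a / (a + b) := div_pos ha (add_pos ha hb)
  have hl1 : a / (a + b) < 1 := (div_lt_one (add_pos ha hb)).2 (lt_add_of_pos_right a hb)
  refine ⟨a / (a + b), hl0, hl1, ?_⟩
  nth_rw 1 [← exp_binEntropy_mul_rpow_mul_rpow ha hb]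
  have hc := youngExponent_lt_one hl0 hl1 hq0 hq1
  have hβ : ∀ i, 0 < becknerConst (youngExponent (a / (a + b)) q i) := fun i ↦
    becknerConst_pos (pos_of_sum_eq_two hc (sum_youngExponent _ _) i) (hc i)
  gcongr
  rw [rpow_def_of_pos (prod_pos fun i _ ↦ hβ i), exp_le_exp, log_prod fun i _ ↦ (hβ i).ne',
    mul_comm, Fin.sum_univ_three]
  exact binEntropy_le_log_becknerConst hq0 hq1 hl0 hl1 hα

theorem ennreal_rpow_le_rpow_of_nonpos {z : ℝ} (hz : z ≤ 0) {x y : ENNReal} (h : x ≤ y) :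
    y ^ z ≤ x ^ z := by
  rw [← neg_neg z, ENNReal.rpow_neg, ENNReal.rpow_neg x]
  exact ENNReal.inv_le_inv.2 (ENNReal.rpow_le_rpow h (neg_nonneg.2 hz))

theorem exists_add_le_ofReal_becknerConst_rpow_mul {q α : ℝ} (hq0 : 0 < q) (hq1 : q < 1)
    (hα : (2 - q) / (2 * (1 - q)) ≤ α) {A B : ENNReal} (hA0 : A ≠ 0) (hA : A ≠ ⊤)
    (hB0 : B ≠ 0) (hB : B ≠ ⊤) :
    ∃ l, 0 < l ∧ l < 1 ∧
      A + B ≤ ENNReal.ofReal (∏ i, becknerConst (youngExponent l q i)) ^ (-(2 * α / q)) *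
        (A ^ l * B ^ (1 - l)) := by
  have ha := ENNReal.toReal_pos hA0 hA
  have hb := ENNReal.toReal_pos hB0 hB
  obtain ⟨l, hl0, hl1, h⟩ := exists_add_le_becknerConst_rpow_mul hq0 hq1 hα ha hb
  have hc := youngExponent_lt_one hl0 hl1 hq0 hq1
  have hK : 0 < ∏ i, becknerConst (youngExponent l q i) := prod_pos fun i _ ↦
    becknerConst_pos (pos_of_sum_eq_two hc (sum_youngExponent _ _) i) (hc i)
  refine ⟨l, hl0, hl1, ?_⟩
  rw [← ENNReal.ofReal_toReal hA, ← ENNReal.ofReal_toReal hB,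
    ← ENNReal.ofReal_add ha.le hb.le, ENNReal.ofReal_rpow_of_pos ha, ENNReal.ofReal_rpow_of_pos hb,
    ENNReal.ofReal_rpow_of_pos hK, ← ENNReal.ofReal_mul (by positivity),
    ← ENNReal.ofReal_mul (by positivity)]
  exact ENNReal.ofReal_le_ofReal h

theorem rpow_add_rpow_le_lintegral_lconvolution_rpow_of_ne_top {d : ℕ} (hd : 0 < d) {p α : ℝ}
    (hp : 1 < p) (hα : (p + 1) / 2 ≤ α) {f g : EuclideanSpace ℝ (Fin d) → ENNReal}
    (hf : Measurable f) (hg : Measurable g) (hf1 : ∫⁻ x, f x = 1) (hg1 : ∫⁻ x, g x = 1)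
    (hfp : ∫⁻ x, f x ^ p ≠ ⊤) (hgp : ∫⁻ x, g x ^ p ≠ ⊤) :
    (∫⁻ x, f x ^ p) ^ (-(2 / d / (p - 1) * α)) + (∫⁻ x, g x ^ p) ^ (-(2 / d / (p - 1) * α)) ≤
      (∫⁻ x, lconvolution f g volume x ^ p) ^ (-(2 / d / (p - 1) * α)) := by
  have hp0 : 0 < p := one_pos.trans hp
  have hp1 : 0 < p - 1 := sub_pos.2 hp
  have hf0 := lintegral_rpow_ne_zero hf (hf1 ▸ one_ne_zero) hp0
  have hg0 := lintegral_rpow_ne_zero hg (hg1 ▸ one_ne_zero) hp0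
  set e := 2 / d / (p - 1) * α with he
  have he0 : 0 < e := by
    have : 0 < α := by linarith
    positivity
  obtain ⟨l, hl0, hl1, entropy⟩ := exists_add_le_ofReal_becknerConst_rpow_mul
    (q := 1 - 1 / p) (α := α) (sub_pos.2 ((div_lt_one hp0).2 hp))
    (sub_lt_self _ (one_div_pos.2 hp0)) (hα.trans' (le_of_eq (by field_simp; ring)))
    (ENNReal.rpow_pos (pos_iff_ne_zero.2 hf0) hfp).ne' (ENNReal.rpow_ne_top_of_ne_zero hf0 hfp)
    (ENNReal.rpow_pos (pos_iff_ne_zero.2 hg0) hgp).ne' (ENNReal.rpow_ne_top_of_ne_zero hg0 hgp)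
  have young := lintegral_lconvolution_rpow_le_becknerConst hp hf hg hf1 hg1 hl0 hl1
  refine (entropy.trans_eq ?_).trans
    (ennreal_rpow_le_rpow_of_nonpos (neg_nonpos.2 he0.le) young)
  have hFl : (∫⁻ x, f x ^ p) ^ l ≠ ⊤ := ENNReal.rpow_ne_top_of_nonneg hl0.le hfp
  have hGl : (∫⁻ x, g x ^ p) ^ (1 - l) ≠ ⊤ := ENNReal.rpow_ne_top_of_nonneg (sub_pos.2 hl1).le hgp
  have hK := ENNReal.pow_ne_top (n := d) (ENNReal.ofReal_ne_top
    (r := ∏ i, becknerConst (youngExponent l (1 - 1 / p) i)))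
  have exponent : d * p * -e = -(2 * α / (1 - 1 / p)) := by
    rw [one_sub_div hp0.ne', he]
    field_simp
  rw [ENNReal.mul_rpow_of_ne_top (ENNReal.rpow_ne_top_of_nonneg hp0.le hK)
      (ENNReal.mul_ne_top hFl hGl), ENNReal.mul_rpow_of_ne_top hFl hGl, ← exponent]
  simp only [← ENNReal.rpow_mul, ← ENNReal.rpow_natCast, mul_comm (-e)]

theorem rpow_add_rpow_le_lintegral_lconvolution_rpow {d : ℕ} (hd : 0 < d) {p α : ℝ}
    (hp : 1 < p) (hα : (p + 1) / 2 ≤ α) {f g : EuclideanSpace ℝ (Fin d) → ENNReal}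
    (hf : Measurable f) (hg : Measurable g) (hf1 : ∫⁻ x, f x = 1) (hg1 : ∫⁻ x, g x = 1) :
    (∫⁻ x, f x ^ p) ^ (-(2 / d / (p - 1) * α)) + (∫⁻ x, g x ^ p) ^ (-(2 / d / (p - 1) * α)) ≤
      (∫⁻ x, lconvolution f g volume x ^ p) ^ (-(2 / d / (p - 1) * α)) := by
  have he : -(2 / d / (p - 1) * α) < 0 := by
    have := sub_pos.2 hp
    have : 0 < α := by linarith
    simp only [neg_neg_iff_pos]
    positivity
  by_cases hfp : ∫⁻ x, f x ^ p = ⊤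
  · rw [hfp, ENNReal.top_rpow_of_neg he, zero_add]
    refine ennreal_rpow_le_rpow_of_nonpos he.le ?_
    simpa only [hf1, ENNReal.one_rpow, one_mul] using lintegral_lconvolution_rpow_le hp.le hf hg
  by_cases hgp : ∫⁻ x, g x ^ p = ⊤
  · rw [hgp, ENNReal.top_rpow_of_neg he, add_zero, lconvolution_comm]
    refine ennreal_rpow_le_rpow_of_nonpos he.le ?_
    simpa only [hg1, ENNReal.one_rpow, one_mul] using lintegral_lconvolution_rpow_le hp.le hg hf
  exact rpow_add_rpow_le_lintegral_lconvolution_rpow_of_ne_top hd hp hα hf hg hf1 hg1 hfp hgp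

section Scaling

variable {E : Type*} [NormedAddCommGroup E] [NormedSpace ℝ E] [FiniteDimensional ℝ E]
  [MeasurableSpace E] [BorelSpace E] (μ : Measure E) [μ.IsAddHaarMeasure] {c : ℝ}

theorem lintegral_comp_smul (f : E → ENNReal) (hc : c ≠ 0) :
    ∫⁻ x, f (c • x) ∂μ = ENNReal.ofReal |(c ^ Module.finrank ℝ E)⁻¹| * ∫⁻ x, f x ∂μ := by
  have := lintegral_map_equiv (μ := μ) f (MeasurableEquiv.smul₀ c hc)
  rwa [MeasurableEquiv.coe_smul₀, Measure.map_addHaar_smul μ hc, lintegral_smul_measure,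
    smul_eq_mul, eq_comm] at this

variable {Ω : Type*} [MeasurableSpace Ω] {P : Measure Ω} {X : Ω → E} [HasPDF X P μ]

theorem hasPDF_const_smul [SFinite P] (hc : c ≠ 0) : HasPDF (c • X) P μ :=
  pdf.quasiMeasurePreserving_hasPDF' X (Measure.quasiMeasurePreserving_smul μ hc)

theorem pdf_const_smul_ae_eq [IsFiniteMeasure P] (hc : c ≠ 0) :
    (fun x ↦ pdf (c • X) P μ (c • x)) =ᵐ[μ]
      fun x ↦ ENNReal.ofReal |(c ^ Module.finrank ℝ E)⁻¹| * pdf X P μ x := by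
  set k := ENNReal.ofReal |(c ^ Module.finrank ℝ E)⁻¹|
  have hk : k ≠ 0 := by
    simpa only [k, ne_eq, ENNReal.ofReal_eq_zero, not_le, abs_pos] using
      inv_ne_zero (pow_ne_zero _ hc)
  have hmap : (P.map X).map (c • ·) = P.map (c • X) :=
    AEMeasurable.map_map_of_aemeasurable (by fun_prop) (HasPDF.aemeasurable X P μ)
  have change := (MeasurableEquiv.smul₀ c hc).measurableEmbedding.rnDeriv_map (P.map X) μ
  rw [MeasurableEquiv.coe_smul₀, hmap, Measure.map_addHaar_smul μ hc] at change
  have scale := (Measure.quasiMeasurePreserving_smul μ hc).ae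
    (Measure.rnDeriv_smul_right_of_ne_top' (P.map (c • X)) μ (r := k) hk ENNReal.ofReal_ne_top)
  filter_upwards [change, scale] with x hx hx'
  rw [pdf_def, pdf_def, ← hx, hx', Pi.smul_apply, smul_eq_mul,
    ENNReal.mul_inv_cancel_left hk ENNReal.ofReal_ne_top]

theorem lintegral_pdf_const_smul_rpow [IsFiniteMeasure P] (hc : c ≠ 0) {p : ℝ} (hp : 0 ≤ p) :
    ∫⁻ x, pdf (c • X) P μ x ^ p ∂μ =
      ENNReal.ofReal |(c ^ Module.finrank ℝ E)⁻¹| ^ (p - 1) * ∫⁻ x, pdf X P μ x ^ p ∂μ := by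
  set k := ENNReal.ofReal |(c ^ Module.finrank ℝ E)⁻¹|
  have hk : k ≠ 0 := by
    simpa only [k, ne_eq, ENNReal.ofReal_eq_zero, not_le, abs_pos] using
      inv_ne_zero (pow_ne_zero _ hc)
  have dilate := lintegral_comp_smul μ (fun x ↦ pdf (c • X) P μ x ^ p) hc
  have density : ∫⁻ x, pdf (c • X) P μ (c • x) ^ p ∂μ = ∫⁻ x, k ^ p * pdf X P μ x ^ p ∂μ := by
    refine lintegral_congr_ae ?_
    filter_upwards [pdf_const_smul_ae_eq (P := P) (X := X) μ hc] with x hx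
    rw [hx, ENNReal.mul_rpow_of_nonneg _ _ hp]
  rw [density, lintegral_const_mul _ ((measurable_pdf X P μ).pow_const p)] at dilate
  have split_pow : k ^ p = k * k ^ (p - 1) := by
    simpa only [ENNReal.rpow_one, add_sub_cancel] using
      ENNReal.rpow_add 1 (p - 1) hk ENNReal.ofReal_ne_top
  rw [← ENNReal.mul_right_inj hk ENNReal.ofReal_ne_top, ← dilate, ← mul_assoc, split_pow]

end Scaling

section RandomVector

variable {Ω : Type*} [MeasurableSpace Ω] {P : Measure Ω} {d : ℕ} {p : ℝ}
  {X Y : Ω → EuclideanSpace ℝ (Fin d)}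

theorem renyiEntropyPower_eq_rpow :
    renyiEntropyPower p X P = (∫⁻ x, pdf X P volume x ^ p) ^ (-(2 / d / (p - 1))) := by
  rw [renyiEntropyPower, renyiEntropy, ← mul_assoc, ← EReal.coe_mul, ← ENNReal.log_rpow,
    ENNReal.exp_log, ← neg_sub p 1, one_div, inv_neg, mul_neg, ← div_eq_mul_inv]

theorem renyiEntropyPower_smul [IsFiniteMeasure P] [HasPDF X P volume] (hd : 0 < d) (hp : 1 < p)
    {c : ℝ} (hc : c ≠ 0) :
    renyiEntropyPower p (c • X) P = ENNReal.ofReal (c ^ 2) * renyiEntropyPower p X P := by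
  have hd' : (d : ℝ) ≠ 0 := Nat.cast_ne_zero.2 hd.ne'
  have hp1 : p - 1 ≠ 0 := (sub_pos.2 hp).ne'
  have hc' : 0 < |c| := abs_pos.2 hc
  have hk : 0 < |(c ^ d)⁻¹| := by positivity
  have hk0 : ENNReal.ofReal |(c ^ d)⁻¹| ^ (p - 1) ≠ 0 :=
    (ENNReal.rpow_pos (ENNReal.ofReal_pos.2 hk) ENNReal.ofReal_ne_top).ne'
  have hk' : ENNReal.ofReal |(c ^ d)⁻¹| ^ (p - 1) ≠ ⊤ :=
    ENNReal.rpow_ne_top_of_nonneg (sub_pos.2 hp).le ENNReal.ofReal_ne_top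
  have scale : |(c ^ d)⁻¹| ^ ((p - 1) * -(2 / d / (p - 1))) = c ^ 2 := by
    rw [show (p - 1) * -(2 / d / (p - 1)) = -(2 / d) by field_simp, abs_inv, abs_pow,
      inv_rpow (by positivity), rpow_neg (by positivity), inv_inv, ← rpow_natCast,
      ← rpow_mul hc'.le, mul_div_cancel₀ _ hd', rpow_two, sq_abs]
  rw [renyiEntropyPower_eq_rpow, renyiEntropyPower_eq_rpow,
    lintegral_pdf_const_smul_rpow volume hc (one_pos.trans hp).le, finrank_euclideanSpace_fin,
    ENNReal.mul_rpow_eq_ite, if_neg (by tauto), ← ENNReal.rpow_mul, ENNReal.ofReal_rpow_of_pos hk,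
    scale]

theorem renyiEntropyPower_rpow_add_le [IsProbabilityMeasure P] [HasPDF X P volume]
    [HasPDF Y P volume] (hd : 0 < d) (hXY : IndepFun X Y P) (hp : 1 < p) {α : ℝ}
    (hα : (p + 1) / 2 ≤ α) :
    renyiEntropyPower p X P ^ α + renyiEntropyPower p Y P ^ α ≤
      renyiEntropyPower p (X + Y) P ^ α := by
  have hsum : ∫⁻ x, pdf (X + Y) P volume x ^ p =
      ∫⁻ x, lconvolution (pdf X P volume) (pdf Y P volume) volume x ^ p :=
    lintegral_congr_ae <| (hXY.pdf_add_eq_lconvolution_pdf (μ := volume)).fun_comp (· ^ p)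
  simp only [renyiEntropyPower_eq_rpow, ← ENNReal.rpow_mul, neg_mul, hsum]
  refine rpow_add_rpow_le_lintegral_lconvolution_rpow hd hp hα (measurable_pdf _ _ _)
    (measurable_pdf _ _ _) ?_ ?_ <;> rw [pdf.lintegral_eq_measure_univ, measure_univ]

end RandomVector

end

theorem theorem3 {Ω : Type*} [MeasurableSpace Ω] (P : Measure Ω) [IsProbabilityMeasure P]
    {d : ℕ} (hd : 0 < d) (X Y : Ω → EuclideanSpace ℝ (Fin d))
    (hX : HasPDF X P volume) (hY : HasPDF Y P volume) (hXY : IndepFun X Y P)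
    (t : ℝ) (ht0 : 0 < t) (ht1 : t < 1)
    (p : ℝ) (hp : 1 < p) (α : ℝ) (hα : (p + 1) / 2 ≤ α) :
    HasPDF (weightedSum t X Y) P volume ∧
      ENNReal.ofReal t ^ α * renyiEntropyPower p X P ^ α +
          ENNReal.ofReal (1 - t) ^ α * renyiEntropyPower p Y P ^ α ≤
        renyiEntropyPower p (weightedSum t X Y) P ^ α := by
  have hα0 : 0 ≤ α := by linarith
  have ht1' : 0 < 1 - t := sub_pos.2 ht1
  have hs := (Real.sqrt_pos.2 ht0).ne'
  have hs' := (Real.sqrt_pos.2 ht1').ne'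
  have : HasPDF (√t • X) P volume := hasPDF_const_smul volume hs
  have : HasPDF (√(1 - t) • Y) P volume := hasPDF_const_smul volume hs'
  have hind : IndepFun (√t • X) (√(1 - t) • Y) P :=
    hXY.comp (φ := (√t • ·)) (ψ := (√(1 - t) • ·)) (by fun_prop) (by fun_prop)
  refine ⟨hind.add_hasPDF, ?_⟩
  have epi := renyiEntropyPower_rpow_add_le hd hind hp hα
  rwa [renyiEntropyPower_smul hd hp hs, renyiEntropyPower_smul hd hp hs', Real.sq_sqrt ht0.le,
    Real.sq_sqrt ht1'.le, ENNReal.mul_rpow_of_nonneg _ _ hα0,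
    ENNReal.mul_rpow_of_nonneg _ _ hα0] at epi
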